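/- Let $X$ be a (real or complex) Banach space and let $L(X)$ denote the algebra of bounded linear operators on $X$. For $T\in L(X)$ let $N(T)$ and $R(T)$ be its null space and range, and put $\operatorname{dis}(T)=\inf\{n\in\mathbb N : R(T^n)\cap N(T)\subseteq R(T^m)\cap N(T)\ \text{for all } m\ge n\}$, where $\mathbb N=\{0,1,2,\dots\}$ and $\inf\emptyset=\infty$. The operator $T$ is called quasi-Fredholm if there is $d\in\mathbb N$ such that $\operatorname{dis}(T)=d$ and both $N(T)\cap R(T^d)$ and $R(T)+N(T^d)$ are closed and complemented subspaces of $X$. Theorem. Let $T\in L(X)$ be quasi-Fredholm and let $F\in L(X)$ have finite rank. Then $T+F$ is quasi-Fredholm. Moreover, with $d=\operatorname{dis}(T)$ and $d'=\operatorname{dis}(T+F)$ (both finite): 1. if $N(T)\cap R(T^d)$ is finite-dimensional, then $N(T+F)\cap R((T+F)^{d'})$ is finite-dimensional; 2. if $R(T)+N(T^d)$ has finite codimension in $X$, then $R(T+F)+N((T+F)^{d'})$ has finite codimension in $X$. -/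

import Mathlib

/-- The set `Δ(T)` of all `n` such that `R(T^n) ∩ N(T) ⊆ R(T^m) ∩ N(T)` for every `m ≥ n`. -/
def stableIterationSet {𝕜 X : Type*} [RCLike 𝕜] [NormedAddCommGroup X] [NormedSpace 𝕜 X]
    (T : X →L[𝕜] X) : Set ℕ :=
  {n | ∀ m : ℕ, n ≤ m →
    (T ^ n).range ⊓ T.ker ≤ (T ^ m).range ⊓ T.ker}

/-- The degree of stable iteration `dis(T) = inf Δ(T)`, equal to `∞` if `Δ(T)` is empty. -/
noncomputable def dis {𝕜 X : Type*} [RCLike 𝕜] [NormedAddCommGroup X] [NormedSpace 𝕜 X]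
    (T : X →L[𝕜] X) : ℕ∞ :=
  ⨅ n ∈ stableIterationSet T, (n : ℕ∞)

/-- `T` is quasi-Fredholm of degree `d`: `dis(T) = d`, and both `N(T) ∩ R(T^d)` and
`R(T) + N(T^d)` are closed and (topologically) complemented subspaces. -/
def IsQuasiFredholmOfDegree {𝕜 X : Type*} [RCLike 𝕜] [NormedAddCommGroup X] [NormedSpace 𝕜 X]
    (T : X →L[𝕜] X) (d : ℕ) : Prop :=
  dis T = (d : ℕ∞) ∧
  (IsClosed ((T.ker ⊓ (T ^ d).range : Submodule 𝕜 X) : Set X) ∧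
    (T.ker ⊓ (T ^ d).range).ClosedComplemented) ∧
  (IsClosed ((T.range ⊔ (T ^ d).ker : Submodule 𝕜 X) : Set X) ∧
    (T.range ⊔ (T ^ d).ker).ClosedComplemented)

/-- `T` is quasi-Fredholm if it is quasi-Fredholm of some degree `d ∈ ℕ`. -/
def IsQuasiFredholm {𝕜 X : Type*} [RCLike 𝕜] [NormedAddCommGroup X] [NormedSpace 𝕜 X]
    (T : X →L[𝕜] X) : Prop :=
  ∃ d : ℕ, IsQuasiFredholmOfDegree T d

/-!
Write `S = T + F`. The proof separates the algebra of iterated kernels and ranges from the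
closedness of ranges.

*Algebra.* Subspaces are compared up to finite dimension (`EssLE`); this comparison is compatible
with sums and intersections, and passing from `T` to `S` changes `N(T)`, `R(T)`, `N(T ^ n)` and
`R(T ^ n)` only up to finite dimension. Hence, once `dis(S)` is known to be finite, the subspaces
attached to `S` agree up to finite dimension with those attached to `T`, because both may be
computed with one common large exponent. This gives the two statements on finite dimension and
finite codimension. Finiteness of `dis(S)` is the delicate point. By induction on the rank, `S` and
`T` may be assumed to agree on a hyperplane `ker f`. If a vector of `N(T) ∩ R(T ^ d)` can be pulled
back along `T` arbitrarily often inside `ker f`, it lies in every `R(S ^ n)`. The freedom in the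
choice of preimages makes this possible on a subspace of codimension at most one
(`StableAt.exists_essLE_of_eqOn_ker`): with `k` minimal such that `f` does not vanish on
`N(T ^ (k + 1)) ∩ R(T ^ d)`, a vector `z` there with `f z ≠ 0` can be used to correct the newest
preimage, while the vectors `T z, T ^ 2 z, …` by which the older ones change lie in `ker f`. The
decreasing sequence `N(S) ∩ R(S ^ n)` then has an essential lower bound, so it stabilizes.

*Closedness.* For `n ≥ d` the range `R(T ^ n)` is closed (`StableAt.isClosed_range_pow`). The space
`R(T ^ n) + N(T ^ d)` is closed by the open mapping theorem, and one descends to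
`R(T ^ n) + N(T ^ j)` with `j = 0` by Neubauer's lemma (`isClosed_range_of_sup_of_inf`), using that
`N(T) ∩ R(T ^ d)` is closed. Finite-rank perturbations preserve closed range, so `R(S ^ n)` is
closed for large `n`, and therefore so are `N(S) ∩ R(S ^ n)` and
`R(S) + N(S ^ n) = (S ^ n)⁻¹ R(S ^ (n + 1))`. Finally, a closed subspace that differs from a
complemented one only by finite dimensions is complemented (`closedComplemented_of_essLE`).
-/

/-! ### Inclusion of subspaces up to finite dimension -/

section EssentialInclusion

variable {K V : Type*} [Field K] [AddCommGroup V] [Module K V]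

/-- `A` is contained in `B` up to a finite-dimensional subspace, i.e. `A ∩ B` has finite
codimension in `A`. -/
def EssLE (A B : Submodule K V) : Prop :=
  ∃ C : Submodule K V, C.FG ∧ A ≤ B ⊔ C

lemma EssLE.of_le {A B : Submodule K V} (h : A ≤ B) : EssLE A B :=
  ⟨⊥, Submodule.fg_bot, h.trans le_sup_left⟩

lemma EssLE.trans {A B D : Submodule K V} (h₁ : EssLE A B) (h₂ : EssLE B D) : EssLE A D := by
  obtain ⟨C₁, hC₁, h₁⟩ := h₁
  obtain ⟨C₂, hC₂, h₂⟩ := h₂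
  refine ⟨C₂ ⊔ C₁, hC₂.sup hC₁, h₁.trans ?_⟩
  rw [← sup_assoc]
  exact sup_le_sup_right h₂ C₁

lemma EssLE.sup {A B A' B' : Submodule K V} (h : EssLE A B) (h' : EssLE A' B') :
    EssLE (A ⊔ A') (B ⊔ B') := by
  obtain ⟨C, hC, h⟩ := h
  obtain ⟨C', hC', h'⟩ := h'
  refine ⟨C ⊔ C', hC.sup hC', ?_⟩
  rw [sup_sup_sup_comm]
  exact sup_le_sup h h'

/-- Essential inclusion can be tested on a subspace of finite codimension; in this form it is
visibly compatible with intersections. -/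
lemma essLE_iff_exists_coFG {A B : Submodule K V} :
    EssLE A B ↔ ∃ Z : Submodule K V, Z.CoFG ∧ A ⊓ Z ≤ B := by
  constructor
  · rintro ⟨C, hC, h⟩
    obtain ⟨Q, hQ⟩ := (C.map B.mkQ).exists_isCompl
    have hQfg : Q.CoFG := (hC.map B.mkQ).cofg_of_isCompl hQ
    refine ⟨Q.comap B.mkQ, ?_, ?_⟩
    · have : Q.comap B.mkQ = LinearMap.ker (Q.mkQ ∘ₗ B.mkQ) := by
        rw [LinearMap.ker_comp, Submodule.ker_mkQ]
      rw [this]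
      have : IsNoetherian K ((V ⧸ B) ⧸ Q) := isNoetherian_of_isNoetherianRing_of_finite K _
      exact Submodule.CoFG.ker _
    · rintro a ⟨ha, haQ⟩
      have haC : B.mkQ a ∈ C.map B.mkQ := by
        obtain ⟨b, hb, c, hc, rfl⟩ := Submodule.mem_sup.1 (h ha)
        exact ⟨c, hc, by simp [(Submodule.Quotient.mk_eq_zero B).2 hb]⟩
      have := Submodule.disjoint_def.1 hQ.disjoint _ haC haQ
      simpa using this
  · rintro ⟨Z, hZ, h⟩
    obtain ⟨C', hC'⟩ := (A ⊓ Z).exists_isCompl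
    refine ⟨A ⊓ C', ?_, ?_⟩
    · refine hZ.fg_of_disjoint (Submodule.disjoint_def.2 fun x hx hxZ => ?_)
      exact Submodule.disjoint_def.1 hC'.disjoint x ⟨hx.1, hxZ⟩ hx.2
    · intro a ha
      obtain ⟨b, hb, c, hc, rfl⟩ :=
        Submodule.mem_sup.1 (hC'.sup_eq_top ▸ Submodule.mem_top : a ∈ (A ⊓ Z) ⊔ C')
      exact Submodule.add_mem_sup (h hb) ⟨(Submodule.add_mem_iff_right A hb.1).1 ha, hc⟩

lemma EssLE.inf {A B A' B' : Submodule K V} (h : EssLE A B) (h' : EssLE A' B') :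
    EssLE (A ⊓ A') (B ⊓ B') := by
  obtain ⟨Z, hZ, h⟩ := essLE_iff_exists_coFG.1 h
  obtain ⟨Z', hZ', h'⟩ := essLE_iff_exists_coFG.1 h'
  exact essLE_iff_exists_coFG.2 ⟨Z ⊓ Z', hZ.inf hZ', fun x hx =>
    ⟨h ⟨hx.1.1, hx.2.1⟩, h' ⟨hx.1.2, hx.2.2⟩⟩⟩

lemma EssLE.fg {A B : Submodule K V} (h : EssLE A B) (hB : B.FG) : A.FG := by
  obtain ⟨C, hC, h⟩ := h
  have : FiniteDimensional K (B ⊔ C : Submodule K V) := Module.Finite.iff_fg.2 (hB.sup hC)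
  exact Module.Finite.iff_fg.1 (Submodule.finiteDimensional_of_le h)

lemma EssLE.coFG {A B : Submodule K V} (h : EssLE A B) (hA : A.CoFG) : B.CoFG := by
  obtain ⟨Z, hZ, h⟩ := essLE_iff_exists_coFG.1 h
  exact (hA.inf hZ).of_le h

lemma EssLE.ker_of_sub {S T : Module.End K V} (h : (S - T).HasFiniteRange) :
    EssLE (LinearMap.ker S) (LinearMap.ker T) := by
  refine essLE_iff_exists_coFG.2 ⟨LinearMap.ker (S - T), h.cofg_ker, fun x hx => ?_⟩
  have h₁ : S x = 0 := hx.1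
  have h₂ : S x - T x = 0 := hx.2
  simpa [h₁] using h₂

lemma EssLE.range_of_sub {S T : Module.End K V} (h : (S - T).HasFiniteRange) :
    EssLE (LinearMap.range S) (LinearMap.range T) := by
  refine ⟨LinearMap.range (S - T), h, ?_⟩
  rintro _ ⟨x, rfl⟩
  exact Submodule.mem_sup.2 ⟨T x, ⟨x, rfl⟩, (S - T) x, ⟨x, rfl⟩, by simp⟩

lemma hasFiniteRange_pow_sub_pow {S T : Module.End K V} (h : (S - T).HasFiniteRange) (n : ℕ) :
    (S ^ n - T ^ n).HasFiniteRange := by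
  induction n with
  | zero => simp
  | succ n ih =>
    have : S ^ (n + 1) - T ^ (n + 1) = (S ^ n) ∘ₗ (S - T) + (S ^ n - T ^ n) ∘ₗ T := by
      ext x
      simp [pow_succ]
    rw [this]
    exact LinearMap.HasFiniteRange.add (h.comp_left _) (ih.comp_right _)

/-- A decreasing sequence of subspaces with an essential lower bound is eventually constant. -/
lemma exists_forall_le_of_essLE {D : ℕ → Submodule K V} (hD : Antitone D) {B : Submodule K V}
    (hB : ∀ n, B ≤ D n) {d : ℕ} (h : EssLE (D d) B) : ∃ e, ∀ n, D e ≤ D n := by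
  obtain ⟨C, hC, hle⟩ := h
  let Q := C.map B.mkQ
  have : FiniteDimensional K Q := Module.Finite.iff_fg.2 (hC.map _)
  let f : ℕ →o (Submodule K Q)ᵒᵈ :=
    { toFun := fun n => OrderDual.toDual (((D n).map B.mkQ).comap Q.subtype)
      monotone' := fun m n hmn => Submodule.comap_mono (Submodule.map_mono (hD hmn)) }
  obtain ⟨e, he⟩ := IsArtinian.monotone_stabilizes f
  refine ⟨max d e, fun n => ?_⟩
  rcases le_total n (max d e) with hn | hn
  · exact hD hn
  intro x hx
  have hxQ : B.mkQ x ∈ Q := by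
    obtain ⟨b, hb, c, hc, rfl⟩ := Submodule.mem_sup.1 (hle (hD (le_max_left d e) hx))
    exact ⟨c, hc, by simp [(Submodule.Quotient.mk_eq_zero B).2 hb]⟩
  have heq : ((D (max d e)).map B.mkQ).comap Q.subtype = ((D n).map B.mkQ).comap Q.subtype :=
    (he _ (le_max_right _ _)).symm.trans (he _ ((le_max_right _ _).trans hn))
  have hmem : (⟨B.mkQ x, hxQ⟩ : Q) ∈ ((D (max d e)).map B.mkQ).comap Q.subtype := ⟨x, hx, rfl⟩
  rw [heq] at hmem
  obtain ⟨y, hy, hyx⟩ := hmem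
  have : x - y ∈ B := (Submodule.Quotient.eq B).1 hyx.symm
  simpa using (D n).add_mem (hB n this) hy

end EssentialInclusion

/-! ### Stable iteration under finite-rank perturbations -/

section StableIteration

variable {K V : Type*} [Field K] [AddCommGroup V] [Module K V]

/-- The subspaces `N(T) ∩ R(T ^ n)` are constant from `n = d` on. The inclusions for `n < d` hold
trivially, so no restriction on `n` is imposed. -/
def StableAt (T : Module.End K V) (d : ℕ) : Prop :=
  ∀ n, LinearMap.ker T ⊓ LinearMap.range (T ^ d) ≤ LinearMap.range (T ^ n)

lemma range_pow_antitone (T : Module.End K V) : Antitone fun n => LinearMap.range (T ^ n) :=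
  T.iterateRange.monotone

lemma StableAt.mono {T : Module.End K V} {d e : ℕ} (h : StableAt T d) (hde : d ≤ e) :
    StableAt T e :=
  fun n => (inf_le_inf_left _ (range_pow_antitone T hde)).trans (h n)

lemma StableAt.ker_inf_range_eq {T : Module.End K V} {d e : ℕ} (h : StableAt T d) (hde : d ≤ e) :
    LinearMap.ker T ⊓ LinearMap.range (T ^ e) = LinearMap.ker T ⊓ LinearMap.range (T ^ d) :=
  le_antisymm (inf_le_inf_left _ (range_pow_antitone T hde)) (le_inf inf_le_left (h e))

lemma range_sup_ker_pow_eq_comap (T : Module.End K V) (n : ℕ) :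
    LinearMap.range T ⊔ LinearMap.ker (T ^ n) = (LinearMap.range (T ^ (n + 1))).comap (T ^ n) := by
  rw [← Submodule.comap_map_eq, pow_succ, Module.End.mul_eq_comp, LinearMap.range_comp]

lemma StableAt.ker_pow_succ_le {T : Module.End K V} {d : ℕ} (h : StableAt T d) (n : ℕ) :
    LinearMap.ker (T ^ (d + 1)) ≤ LinearMap.range (T ^ n) ⊔ LinearMap.ker (T ^ d) := by
  intro x hx
  have hx' : T ((T ^ d) x) = 0 := by
    rw [← Module.End.mul_apply, ← pow_succ']
    exact hx
  obtain ⟨w, hw⟩ := h (d + n) ⟨hx', ⟨x, rfl⟩⟩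
  refine Submodule.mem_sup.2 ⟨(T ^ n) w, ⟨w, rfl⟩, x - (T ^ n) w, ?_, by simp⟩
  rw [LinearMap.mem_ker, map_sub, ← Module.End.mul_apply, ← pow_add, hw, sub_self]

lemma StableAt.range_sup_ker_eq {T : Module.End K V} {d e : ℕ} (h : StableAt T d) (hde : d ≤ e) :
    LinearMap.range T ⊔ LinearMap.ker (T ^ e) = LinearMap.range T ⊔ LinearMap.ker (T ^ d) := by
  induction e, hde using Nat.le_induction with
  | base => rfl
  | succ e hde ih =>
    refine le_antisymm (sup_le le_sup_left ?_) ?_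
    · rw [← ih]
      simpa using (h.mono hde).ker_pow_succ_le 1
    · rw [← ih]
      exact sup_le_sup_left (T.iterateKer.monotone e.le_succ) _

/-- On `R(T ^ d)`, every vector annihilated by a power of `T` has a preimage under `T` that again
lies in `R(T ^ d)`. -/
lemma StableAt.mem_range_pow_succ {T : Module.End K V} {d : ℕ} (h : StableAt T d) (j : ℕ) :
    ∀ v ∈ LinearMap.range (T ^ d), (T ^ j) v = 0 → v ∈ LinearMap.range (T ^ (d + 1)) := by
  induction j with
  | zero =>
    intro v _ hv
    have : v = 0 := by simpa using hv
    simp [this]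
  | succ j ih =>
    rintro v ⟨y, rfl⟩ hv
    have hker : T ((T ^ j) ((T ^ d) y)) = 0 := by
      rwa [← Module.End.mul_apply, ← pow_succ']
    have hran : (T ^ j) ((T ^ d) y) ∈ LinearMap.range (T ^ d) :=
      ⟨(T ^ j) y, by rw [← Module.End.mul_apply, ← Module.End.mul_apply, (Commute.refl T).pow_pow]⟩
    obtain ⟨w, hw⟩ := h (j + (d + 1)) ⟨hker, hran⟩
    have hdiff : (T ^ d) y - (T ^ (d + 1)) w ∈ LinearMap.range (T ^ (d + 1)) := by
      refine ih _ ⟨y - T w, ?_⟩ ?_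
      · rw [map_sub, pow_succ, Module.End.mul_apply]
      · rw [map_sub, ← hw, pow_add, Module.End.mul_apply, sub_self]
    simpa using Submodule.add_mem _ hdiff (LinearMap.mem_range_self (T ^ (d + 1)) w)

lemma pow_apply_eq_of_eqOn_ker {S T : Module.End K V} {f : V →ₗ[K] K}
    (hST : ∀ x, f x = 0 → S x = T x) {v : V} {n : ℕ} (hv : ∀ i < n, f ((T ^ i) v) = 0) :
    (S ^ n) v = (T ^ n) v := by
  induction n with
  | zero => simp
  | succ n ih =>
    rw [pow_succ', pow_succ', Module.End.mul_apply, Module.End.mul_apply,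
      ih fun i hi => hv i (hi.trans n.lt_succ_self), hST _ (hv n n.lt_succ_self)]

/-- Let `f` annihilate the `T`-orbit of `v`. Suppose every value of `f` at a nilpotent vector of
`R(T ^ d)` is also taken at some `z ∈ R(T ^ d)` with `T ^ (k + 1) z = 0` whose further iterates
`T z, T ^ 2 z, …` lie in `ker f`. Then `T ^ k v` can be pulled back along `T` arbitrarily often inside
`ker f`: subtracting `z` from a new preimage corrects its `f`-value, and neither the `f`-values of
its iterates nor the end point `T ^ k v` are affected. -/
lemma StableAt.exists_orbit_in_ker {T : Module.End K V} {d : ℕ} (h : StableAt T d)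
    {f : V →ₗ[K] K} {k : ℕ}
    (hf : ∀ v ∈ LinearMap.range (T ^ d), ∀ j, (T ^ j) v = 0 →
      ∃ z ∈ LinearMap.range (T ^ d), (T ^ (k + 1)) z = 0 ∧ f z = f v ∧
        ∀ i, f ((T ^ (i + 1)) z) = 0)
    {v : V} (hvd : v ∈ LinearMap.range (T ^ d)) (hvk : (T ^ (k + 1)) v = 0)
    (hvf : ∀ i, f ((T ^ i) v) = 0) (p : ℕ) :
    ∃ w ∈ LinearMap.range (T ^ d), (∃ j, (T ^ j) w = 0) ∧ (∀ i, f ((T ^ i) w) = 0) ∧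
      (T ^ (k + p)) w = (T ^ k) v := by
  induction p with
  | zero => exact ⟨v, hvd, ⟨_, hvk⟩, hvf, rfl⟩
  | succ p ih =>
    obtain ⟨w, hwd, ⟨j, hj⟩, hwf, hw⟩ := ih
    obtain ⟨y, hy⟩ := h.mem_range_pow_succ j w hwd hj
    have hTy : T ((T ^ d) y) = w := by rwa [← Module.End.mul_apply, ← pow_succ']
    have hjy : (T ^ (j + 1)) ((T ^ d) y) = 0 := by
      rw [pow_succ, Module.End.mul_apply, hTy, hj]
    obtain ⟨z, hzd, hzk, hzf, hzi⟩ := hf _ ⟨y, rfl⟩ _ hjy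
    have hz0 : ∀ m, k + 1 ≤ m → (T ^ m) z = 0 := fun m hm => by
      obtain ⟨r, rfl⟩ := Nat.exists_eq_add_of_le' hm
      rw [pow_add, Module.End.mul_apply, hzk, map_zero]
    refine ⟨(T ^ d) y - z, Submodule.sub_mem _ ⟨y, rfl⟩ hzd, ⟨j + 1 + (k + 1), ?_⟩, ?_, ?_⟩
    · rw [map_sub, hz0 _ (by omega), add_comm (j + 1), pow_add, Module.End.mul_apply, hjy]
      simp
    · rintro (_ | i)
      · simp [hzf]
      · rw [map_sub, map_sub, hzi, pow_succ, Module.End.mul_apply, hTy, hwf, sub_zero]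
    · rw [map_sub, hz0 _ (by omega), sub_zero, ← add_assoc, pow_succ, Module.End.mul_apply, hTy, hw]

/-- If `S` and `T` agree on the hyperplane `ker f`, then all but finitely many dimensions of
`N(T) ∩ R(T ^ d)` lie in every `R(S ^ n)`. -/
lemma StableAt.exists_essLE_of_eqOn_ker {S T : Module.End K V} {d : ℕ} (h : StableAt T d)
    {f : V →ₗ[K] K} (hST : ∀ x, f x = 0 → S x = T x) :
    ∃ B : Submodule K V, EssLE (LinearMap.ker T ⊓ LinearMap.range (T ^ d)) B ∧
      B ≤ LinearMap.ker S ∧ ∀ n, B ≤ LinearMap.range (S ^ n) := by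
  -- With a suitable `k`, the space `B` is the image under `T ^ k` of the vectors in
  -- `N(T ^ (k + 1)) ∩ R(T ^ d)` whose `T`-orbit lies in `ker f`.
  let B (k : ℕ) : Submodule K V :=
    (LinearMap.ker (T ^ (k + 1)) ⊓ LinearMap.range (T ^ d) ⊓
      ⨅ i, LinearMap.ker (f ∘ₗ T ^ i)).map (T ^ k)
  have key : ∀ k, (∀ v ∈ LinearMap.range (T ^ d), ∀ j, (T ^ j) v = 0 →
      ∃ z ∈ LinearMap.range (T ^ d), (T ^ (k + 1)) z = 0 ∧ f z = f v ∧
        ∀ i, f ((T ^ (i + 1)) z) = 0) →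
      B k ≤ LinearMap.ker S ∧ ∀ n, B k ≤ LinearMap.range (S ^ n) := by
    intro k hk
    refine ⟨?_, fun n => ?_⟩
    · rintro _ ⟨v, ⟨⟨hvk, -⟩, hvf⟩, rfl⟩
      have hvf : ∀ i, f ((T ^ i) v) = 0 := by simpa using hvf
      rw [LinearMap.mem_ker, hST _ (hvf k), ← Module.End.mul_apply, ← pow_succ']
      exact hvk
    · rintro _ ⟨v, ⟨⟨hvk, hvd⟩, hvf⟩, rfl⟩
      have hvf : ∀ i, f ((T ^ i) v) = 0 := by simpa using hvf
      obtain ⟨w, -, -, hwf, hw⟩ := h.exists_orbit_in_ker hk hvd hvk hvf n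
      have : (S ^ (k + n)) w = (T ^ k) v := by
        rw [pow_apply_eq_of_eqOn_ker hST fun i _ => hwf i, hw]
      exact range_pow_antitone S (Nat.le_add_left n k) ⟨w, this⟩
  by_cases hnil : ∀ k, ∀ z ∈ LinearMap.range (T ^ d), (T ^ k) z = 0 → f z = 0
  · refine ⟨B 0, EssLE.of_le ?_, key 0 fun v hv j hj => ⟨0, by simp [hnil j v hv hj]⟩⟩
    rintro x ⟨hx, hxd⟩
    refine ⟨x, ⟨⟨by simpa using hx, hxd⟩, ?_⟩, by simp⟩
    have hx : T x = 0 := hx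
    simp only [SetLike.mem_coe, Submodule.mem_iInf, LinearMap.mem_ker, LinearMap.comp_apply]
    rintro (_ | i)
    · exact hnil 1 _ hxd (by simpa using hx)
    · simp [pow_succ, hx]
  · -- Take the least exponent for which `f` does not vanish on `N(T ^ (k + 1)) ∩ R(T ^ d)`.
    push Not at hnil
    classical
    obtain ⟨z, hzd, hzk, hzf⟩ := Nat.find_spec hnil
    have hmin := fun m (hm : m < Nat.find hnil) => Nat.find_min hnil hm
    generalize Nat.find hnil = k at *
    obtain _ | k := k
    · exact absurd (by simpa using hzk : z = 0) (by rintro rfl; simp at hzf)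
    have hlow : ∀ y ∈ LinearMap.range (T ^ d), (T ^ (k + 1)) y = 0 →
        ∀ i, f ((T ^ (i + 1)) y) = 0 := by
      intro y hyd hyk i
      by_contra hne
      refine hmin k k.lt_succ_self ⟨(T ^ (i + 1)) y, ?_, ?_, hne⟩
      · obtain ⟨x, rfl⟩ := hyd
        exact ⟨(T ^ (i + 1)) x, by
          rw [← Module.End.mul_apply, ← Module.End.mul_apply, (Commute.refl T).pow_pow]⟩
      · rw [← Module.End.mul_apply, ← pow_add, show k + (i + 1) = i + (k + 1) by omega, pow_add,
          Module.End.mul_apply, hyk, map_zero]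
    refine ⟨B k, ⟨Submodule.span K {(T ^ k) z}, Submodule.fg_span_singleton _, ?_⟩,
      key k fun v hv j hj => ⟨(f v / f z) • z, Submodule.smul_mem _ _ hzd, ?_, ?_, ?_⟩⟩
    · rintro x ⟨hx, hxd⟩
      have hx : T x = 0 := hx
      obtain ⟨y, rfl⟩ := h (k + d) ⟨hx, hxd⟩
      rw [pow_add, Module.End.mul_apply] at hx ⊢
      rw [← Module.End.mul_apply, ← pow_succ'] at hx
      generalize hv : (T ^ d) y = v at *
      have hvd : v ∈ LinearMap.range (T ^ d) := ⟨y, hv⟩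
      have hv'd := Submodule.sub_mem _ hvd (Submodule.smul_mem _ (f v / f z) hzd)
      have hv'k : (T ^ (k + 1)) (v - (f v / f z) • z) = 0 := by simp [hx, hzk]
      refine Submodule.mem_sup.2 ⟨(T ^ k) (v - (f v / f z) • z), ⟨_, ⟨⟨hv'k, hv'd⟩, ?_⟩, rfl⟩,
        (f v / f z) • (T ^ k) z, Submodule.smul_mem _ _ (Submodule.mem_span_singleton_self _),
        by simp⟩
      simp only [SetLike.mem_coe, Submodule.mem_iInf, LinearMap.mem_ker, LinearMap.comp_apply]
      rintro (_ | i)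
      · simp [hzf]
      · exact hlow _ hv'd hv'k i
    · simp [hzk]
    · simp [hzf]
    · intro i
      simp [hlow z hzd hzk i]

lemma StableAt.exists_of_rank_one {T : Module.End K V} {d : ℕ} (h : StableAt T d)
    (f : V →ₗ[K] K) (x : V) : ∃ e, StableAt (T + f.smulRight x) e := by
  set S := T + f.smulRight x with hS
  have hfin : (S - T).HasFiniteRange := by
    have : S - T = LinearMap.toSpanSingleton K V x ∘ₗ f := by
      ext y; simp [hS]
    rw [this]
    exact LinearMap.HasFiniteRange.of_finite_dom.comp_right f
  obtain ⟨B, hB, hBS, hBn⟩ := h.exists_essLE_of_eqOn_ker (S := S) (f := f)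
    fun y hy => by simp [hS, hy]
  obtain ⟨e, he⟩ := exists_forall_le_of_essLE
    (D := fun n => LinearMap.ker S ⊓ LinearMap.range (S ^ n))
    (fun m n hmn => inf_le_inf_left _ (range_pow_antitone S hmn)) (fun n => le_inf hBS (hBn n))
    (d := d)
    (((EssLE.ker_of_sub hfin).inf (EssLE.range_of_sub (hasFiniteRange_pow_sub_pow hfin d))).trans hB)
  exact ⟨e, fun n => (he n).trans inf_le_right⟩

lemma StableAt.exists_of_finite_rank {T F : Module.End K V} {d : ℕ} (h : StableAt T d)
    (hF : F.HasFiniteRange) : ∃ e, StableAt (T + F) e := by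
  have : FiniteDimensional K (LinearMap.range F) := Module.Finite.iff_fg.2 hF
  let b := Module.finBasis K (LinearMap.range F)
  have hsum : ∀ s : Finset (Fin (Module.finrank K (LinearMap.range F))),
      ∃ e, StableAt (T + ∑ i ∈ s, (b.coord i ∘ₗ F.rangeRestrict).smulRight (b i : V)) e := by
    intro s
    induction s using Finset.induction_on with
    | empty => exact ⟨d, by simpa using h⟩
    | insert i s hi ih =>
      obtain ⟨e, he⟩ := ih
      rw [Finset.sum_insert hi, add_comm (LinearMap.smulRight _ _), ← add_assoc]
      exact he.exists_of_rank_one _ _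
  have hF' : F = ∑ i, (b.coord i ∘ₗ F.rangeRestrict).smulRight (b i : V) := by
    ext x
    have := congrArg (Submodule.subtype _) (b.sum_repr (F.rangeRestrict x))
    rw [map_sum] at this
    simpa using this.symm
  rw [hF']
  exact hsum _

end StableIteration

/-! ### Closed ranges -/

section ClosedRange

variable {𝕜 E X : Type*} [RCLike 𝕜] [NormedAddCommGroup E] [NormedSpace 𝕜 E]
  [NormedAddCommGroup X] [NormedSpace 𝕜 X]

/-- The operator `(x, b) ↦ Φ x + b`, whose range is `R(Φ) + B`. -/
def rangeSupOperator (Φ : E →L[𝕜] X) (B : Submodule 𝕜 X) : E × B →L[𝕜] X :=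
  Φ.coprod B.subtypeL

lemma range_rangeSupOperator (Φ : E →L[𝕜] X) (B : Submodule 𝕜 X) :
    (rangeSupOperator Φ B).range = Φ.range ⊔ B := by
  simp [rangeSupOperator, LinearMap.range_coprod]

lemma isClosed_ker_pow (T : X →L[𝕜] X) (n : ℕ) :
    IsClosed (LinearMap.ker ((T : X →ₗ[𝕜] X) ^ n) : Set X) := by
  rw [← ContinuousLinearMap.toLinearMap_pow]
  exact (T ^ n).isClosed_ker

variable [CompleteSpace E] [CompleteSpace X]

/-- By the open mapping theorem, an operator with closed range maps closed subspaces containing its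
kernel to closed subspaces. -/
lemma isClosed_map_of_ker_le (Φ : E →L[𝕜] X) (hΦ : IsClosed (Φ.range : Set X))
    (W : Submodule 𝕜 E) (hW : IsClosed (W : Set E)) (hker : Φ.ker ≤ W) :
    IsClosed (W.map (Φ : E →ₗ[𝕜] X) : Set X) := by
  have : CompleteSpace Φ.range := hΦ.completeSpace_coe
  have hq : Topology.IsQuotientMap Φ.rangeRestrict :=
    Φ.rangeRestrict.isQuotientMap (LinearMap.surjective_rangeRestrict _)
  have h₁ : IsClosed (Subtype.val ⁻¹' (W.map (Φ : E →ₗ[𝕜] X) : Set X) : Set Φ.range) := by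
    rw [← hq.isClosed_preimage]
    convert hW
    ext x
    constructor
    · rintro ⟨y, hy, hyx⟩
      have : x - y ∈ Φ.ker := by
        simpa [sub_eq_zero] using hyx.symm
      simpa using W.add_mem (hker this) hy
    · intro hx
      exact ⟨x, hx, rfl⟩
  convert hΦ.isClosedEmbedding_subtypeVal.isClosedMap _ h₁
  ext x
  constructor
  · rintro ⟨y, hy, rfl⟩
    exact ⟨⟨Φ y, ⟨y, rfl⟩⟩, ⟨y, hy, rfl⟩, rfl⟩
  · rintro ⟨y, hy, rfl⟩
    exact hy

/-- Neubauer's lemma: an operator range `R(Φ)` is closed as soon as there is a closed subspace `B`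
such that `R(Φ) + B` and `R(Φ) ∩ B` are closed. -/
lemma isClosed_range_of_sup_of_inf (Φ : E →L[𝕜] X) (B : Submodule 𝕜 X)
    (hB : IsClosed (B : Set X)) (hsup : IsClosed ((Φ.range ⊔ B : Submodule 𝕜 X) : Set X))
    (hinf : IsClosed ((Φ.range ⊓ B : Submodule 𝕜 X) : Set X)) :
    IsClosed (Φ.range : Set X) := by
  have : CompleteSpace B := hB.completeSpace_coe
  -- `R(Φ)` is the image of `E × (R(Φ) ∩ B)` under `(x, b) ↦ Φ x + b`.
  let W : Submodule 𝕜 (E × B) :=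
    (Φ.range ⊓ B).comap (B.subtype ∘ₗ LinearMap.snd 𝕜 E B)
  have hW : IsClosed (W : Set (E × B)) :=
    hinf.preimage (continuous_subtype_val.comp continuous_snd)
  have := isClosed_map_of_ker_le (rangeSupOperator Φ B)
    (by rwa [range_rangeSupOperator]) W hW (by
      rintro ⟨x, b⟩ hx
      have hx : Φ x + b = 0 := hx
      exact ⟨⟨-x, by simpa using neg_eq_of_add_eq_zero_right hx⟩, b.2⟩)
  convert this
  ext y
  constructor
  · rintro ⟨x, rfl⟩
    exact ⟨(x, 0), by simp [W], by simp [rangeSupOperator]⟩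
  · rintro ⟨⟨x, b⟩, ⟨⟨x', hx'⟩, -⟩, rfl⟩
    exact ⟨x + x', by simpa [rangeSupOperator] using hx'⟩

lemma isClosed_range_of_sub_finiteRank {Φ Ψ : E →L[𝕜] X} (hΦ : IsClosed (Φ.range : Set X))
    (h : ((Ψ : E →ₗ[𝕜] X) - (Φ : E →ₗ[𝕜] X)).HasFiniteRange) : IsClosed (Ψ.range : Set X) := by
  set C := LinearMap.range ((Ψ : E →ₗ[𝕜] X) - (Φ : E →ₗ[𝕜] X)) with hC
  have : FiniteDimensional 𝕜 C := Module.Finite.iff_fg.2 h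
  have : FiniteDimensional 𝕜 (Ψ.range ⊓ C : Submodule 𝕜 X) :=
    Submodule.finiteDimensional_of_le inf_le_right
  have hsup : Ψ.range ⊔ C = Φ.range ⊔ C := by
    refine le_antisymm (sup_le ?_ le_sup_right) (sup_le ?_ le_sup_right)
    · rintro _ ⟨x, rfl⟩
      exact Submodule.mem_sup.2 ⟨Φ x, ⟨x, rfl⟩, _, ⟨x, rfl⟩, by simp⟩
    · rintro _ ⟨x, rfl⟩
      exact Submodule.mem_sup.2 ⟨Ψ x, ⟨x, rfl⟩, _, C.neg_mem ⟨x, rfl⟩, by simp⟩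
  refine isClosed_range_of_sup_of_inf Ψ C C.closed_of_finiteDimensional ?_
    (Submodule.closed_of_finiteDimensional _)
  rw [hsup]
  exact Submodule.isClosed_sup_finiteDimensional _ _ hΦ

/-- The induced operator on `X ⧸ N(T ^ d)` has closed range and its kernel lies in the ranges of
all its powers, so that these powers have closed range as well. -/
lemma StableAt.isClosed_range_pow_sup_ker {T : X →L[𝕜] X} {d : ℕ}
    (h : StableAt (T : X →ₗ[𝕜] X) d)
    (hsup : IsClosed ((LinearMap.range (T : X →ₗ[𝕜] X) ⊔ LinearMap.ker ((T : X →ₗ[𝕜] X) ^ d) :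
      Submodule 𝕜 X) : Set X)) (n : ℕ) :
    IsClosed ((LinearMap.range ((T : X →ₗ[𝕜] X) ^ n) ⊔ LinearMap.ker ((T : X →ₗ[𝕜] X) ^ d) :
      Submodule 𝕜 X) : Set X) := by
  induction n with
  | zero => simp [Module.End.one_eq_id]
  | succ n ih =>
    set L : Module.End 𝕜 X := (T : X →ₗ[𝕜] X) with hL
    set N := LinearMap.ker (L ^ d) with hN
    have hNc : IsClosed (N : Set X) := isClosed_ker_pow T d
    have : CompleteSpace N := hNc.completeSpace_coe
    let W : Submodule 𝕜 (X × N) :=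
      (LinearMap.range (L ^ n) ⊔ N).comap (LinearMap.fst 𝕜 X N)
    have hW : IsClosed (W : Set (X × N)) := ih.preimage continuous_fst
    have := isClosed_map_of_ker_le (rangeSupOperator T N)
      (by rwa [range_rangeSupOperator]) W hW (by
        rintro ⟨x, b⟩ hx
        have hx : L x + b = 0 := hx
        refine h.ker_pow_succ_le n ?_
        have hb : (L ^ d) (b : X) = 0 := b.2
        change (L ^ (d + 1)) x = 0
        rw [pow_succ, Module.End.mul_apply, eq_neg_of_add_eq_zero_left hx,
          map_neg, hb, neg_zero])
    convert this
    ext y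
    constructor
    · intro hy
      obtain ⟨_, ⟨x, rfl⟩, b, hb, rfl⟩ := Submodule.mem_sup.1 hy
      refine ⟨((L ^ n) x, ⟨b, hb⟩), Submodule.mem_sup_left ⟨x, rfl⟩, ?_⟩
      simp [rangeSupOperator, hL, pow_succ']
    · rintro ⟨⟨x, b⟩, hx, rfl⟩
      obtain ⟨_, ⟨u, rfl⟩, c, hc, hx⟩ := Submodule.mem_sup.1 hx
      have hx : (L ^ n) u + c = x := hx
      have hLc : L c ∈ N := by
        have hc : (L ^ d) c = 0 := hc
        rw [hN, LinearMap.mem_ker, ← Module.End.mul_apply, ← pow_succ, pow_succ',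
          Module.End.mul_apply, hc, map_zero]
      refine Submodule.mem_sup.2 ⟨(L ^ (n + 1)) u, ⟨u, rfl⟩, L c + b, N.add_mem hLc b.2, ?_⟩
      rw [pow_succ', Module.End.mul_apply, ← add_assoc, ← map_add, hx]
      rfl

/-- The powers `T ^ n` with `n ≥ d` have closed range. This descends from the closedness of
`R(T ^ n) + N(T ^ d)` to that of `R(T ^ n) + N(T ^ j)`, for `j = d, d - 1, …, 0`, through Neubauer's
lemma for `R(T ^ n) + N(T ^ j)` and `N(T ^ (j + 1))`. -/
lemma StableAt.isClosed_range_pow {T : X →L[𝕜] X} {d : ℕ}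
    (h : StableAt (T : X →ₗ[𝕜] X) d)
    (hinf : IsClosed ((LinearMap.ker (T : X →ₗ[𝕜] X) ⊓ LinearMap.range ((T : X →ₗ[𝕜] X) ^ d) :
      Submodule 𝕜 X) : Set X))
    (hsup : IsClosed ((LinearMap.range (T : X →ₗ[𝕜] X) ⊔ LinearMap.ker ((T : X →ₗ[𝕜] X) ^ d) :
      Submodule 𝕜 X) : Set X)) {n : ℕ} (hn : d ≤ n) :
    IsClosed (LinearMap.range ((T : X →ₗ[𝕜] X) ^ n) : Set X) := by
  set L : Module.End 𝕜 X := (T : X →ₗ[𝕜] X) with hL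
  have hdesc : ∀ j ≤ d, IsClosed ((LinearMap.range (L ^ n) ⊔ LinearMap.ker (L ^ j) :
      Submodule 𝕜 X) : Set X) := by
    intro j hj
    induction hj using Nat.decreasingInduction with
    | self => exact h.isClosed_range_pow_sup_ker hsup n
    | of_succ j hj ih =>
      have hNc : IsClosed (LinearMap.ker (L ^ j) : Set X) := isClosed_ker_pow T j
      have : CompleteSpace (LinearMap.ker (L ^ j)) := hNc.completeSpace_coe
      have hmono : LinearMap.ker (L ^ j) ≤ LinearMap.ker (L ^ (j + 1)) :=
        L.iterateKer.monotone j.le_succ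
      have hran : (rangeSupOperator (T ^ n) (LinearMap.ker (L ^ j))).range =
          LinearMap.range (L ^ n) ⊔ LinearMap.ker (L ^ j) := by
        rw [range_rangeSupOperator, ContinuousLinearMap.toLinearMap_pow]
      rw [← hran]
      refine isClosed_range_of_sup_of_inf _ (LinearMap.ker (L ^ (j + 1)))
        (isClosed_ker_pow T (j + 1)) ?_ ?_
      · rwa [hran, sup_assoc, sup_eq_right.2 hmono]
      · -- The intersection is the preimage of `N(T) ∩ R(T ^ (j + n))` under `T ^ j`.
        rw [hran]
        have hpre : (LinearMap.range (L ^ n) ⊔ LinearMap.ker (L ^ j)) ⊓ LinearMap.ker (L ^ (j + 1)) =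
            (LinearMap.ker L ⊓ LinearMap.range (L ^ (j + n))).comap (L ^ j) := by
          ext x
          simp only [Submodule.mem_inf, Submodule.mem_comap, LinearMap.mem_ker]
          rw [← Module.End.mul_apply L, ← pow_succ', and_comm]
          refine and_congr_right fun _ => ⟨fun hx => ?_, ?_⟩
          · obtain ⟨_, ⟨y, rfl⟩, z, hz, rfl⟩ := Submodule.mem_sup.1 hx
            have hz : (L ^ j) z = 0 := hz
            exact ⟨y, by rw [map_add, hz, add_zero, pow_add, Module.End.mul_apply]⟩
          · rintro ⟨y, hy⟩
            refine Submodule.mem_sup.2 ⟨(L ^ n) y, ⟨y, rfl⟩, x - (L ^ n) y, ?_, by simp⟩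
            rw [LinearMap.mem_ker, map_sub, ← hy, pow_add, Module.End.mul_apply, sub_self]
        rw [hpre, h.ker_inf_range_eq (hn.trans (Nat.le_add_left n j))]
        have hcont : Continuous (L ^ j) := by
          rw [hL, ← ContinuousLinearMap.toLinearMap_pow]
          exact (T ^ j).continuous
        exact hinf.preimage hcont
  simpa [Module.End.one_eq_id] using hdesc 0 d.zero_le

end ClosedRange

/-! ### Complemented subspaces -/

section Complemented

variable {𝕜 X : Type*} [RCLike 𝕜] [NormedAddCommGroup X] [NormedSpace 𝕜 X]

/-- Complementedness of closed subspaces is insensitive to finite-dimensional changes. -/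
lemma closedComplemented_of_essLE {A B : Submodule 𝕜 X} (hA : A.ClosedComplemented)
    (hB : IsClosed (B : Set X)) (hAB : EssLE A B) (hBA : EssLE B A) : B.ClosedComplemented := by
  -- First, `D = A ∩ B` is complemented in `A`, hence in `X`.
  obtain ⟨p, hp⟩ := hA
  have hfin : FiniteDimensional 𝕜 (A ⧸ B.comap A.subtype) := by
    obtain ⟨Z, hZ, hle⟩ := essLE_iff_exists_coFG.1 hAB
    have : (Z.comap A.subtype).CoFG := by
      have hker : Z.comap A.subtype = LinearMap.ker (Z.mkQ ∘ₗ A.subtype) := by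
        rw [LinearMap.ker_comp, Submodule.ker_mkQ]
      rw [hker]
      have : IsNoetherian 𝕜 (X ⧸ Z) := isNoetherian_of_isNoetherianRing_of_finite 𝕜 _
      exact Submodule.CoFG.ker _
    exact this.of_le fun x hx => hle ⟨x.2, hx⟩
  obtain ⟨r, hr⟩ := Submodule.ClosedComplemented.of_finiteDimensional_quotient
    (p := B.comap A.subtype) (hB.preimage continuous_subtype_val)
  let P : X →L[𝕜] X := A.subtypeL ∘L (B.comap A.subtype).subtypeL ∘L r ∘L p
  have hPmem : ∀ x, P x ∈ A ⊓ B := fun x => ⟨((r (p x) : A)).2, (r (p x)).2⟩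
  have hPfix : ∀ x ∈ A ⊓ B, P x = x := fun x hx => by
    have h₁ : p x = ⟨x, hx.1⟩ := hp ⟨x, hx.1⟩
    have h₂ : r ⟨x, hx.1⟩ = ⟨⟨x, hx.1⟩, hx.2⟩ := hr ⟨⟨x, hx.1⟩, hx.2⟩
    simp [P, h₁, h₂]
  -- Then `B` is the direct sum of `D` and the finite-dimensional space `B ∩ N(P)`.
  have hBD : EssLE B (A ⊓ B) := by
    simpa using hBA.inf (EssLE.of_le (le_refl B))
  let G : Submodule 𝕜 X := B ⊓ P.ker
  have hG : FiniteDimensional 𝕜 G := by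
    obtain ⟨C, hC, hle⟩ := hBD
    refine Module.Finite.iff_fg.2 (EssLE.fg (EssLE.of_le ?_)
      (hC.map (LinearMap.id - (P : X →ₗ[𝕜] X))))
    rintro b ⟨hb, hPb⟩
    obtain ⟨δ, hδ, c, hc, rfl⟩ := Submodule.mem_sup.1 (hle hb)
    have hPb : P (δ + c) = 0 := hPb
    rw [map_add, hPfix δ hδ] at hPb
    refine ⟨c, hc, ?_⟩
    rw [LinearMap.sub_apply, LinearMap.id_apply, ContinuousLinearMap.coe_coe,
      eq_neg_of_add_eq_zero_right hPb, sub_neg_eq_add, add_comm]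
  obtain ⟨q, hq⟩ := Submodule.ClosedComplemented.of_finiteDimensional G
  refine ⟨(P + G.subtypeL ∘L q ∘L (ContinuousLinearMap.id 𝕜 X - P)).codRestrict B fun x =>
    B.add_mem (hPmem x).2 (q (x - P x)).2.1, fun x => Subtype.ext ?_⟩
  have hx : (x : X) - P x ∈ G :=
    ⟨B.sub_mem x.2 (hPmem x).2, by
      change P ((x : X) - P x) = 0
      rw [map_sub, hPfix _ (hPmem x), sub_self]⟩
  have hqx : q ((x : X) - P x) = ⟨_, hx⟩ := hq ⟨_, hx⟩
  change P x + (q ((x : X) - P x) : X) = x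
  rw [hqx]
  simp

end Complemented

/-! ### Quasi-Fredholm operators -/

section QuasiFredholm

variable {𝕜 X : Type*} [RCLike 𝕜] [NormedAddCommGroup X] [NormedSpace 𝕜 X]

lemma mem_stableIterationSet_iff {T : X →L[𝕜] X} {d : ℕ} :
    d ∈ stableIterationSet T ↔ StableAt (T : X →ₗ[𝕜] X) d := by
  simp only [stableIterationSet, Set.mem_ofPred_eq, StableAt, ContinuousLinearMap.toLinearMap_pow]
  constructor
  · intro h n
    rw [inf_comm]
    rcases le_total d n with hn | hn
    · exact (h n hn).trans inf_le_left
    · exact inf_le_left.trans (range_pow_antitone _ hn)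
  · intro h m _
    refine le_inf ?_ inf_le_right
    rw [inf_comm]
    exact h m

lemma stableAt_of_dis_eq {T : X →L[𝕜] X} {d : ℕ} (h : dis T = d) :
    StableAt (T : X →ₗ[𝕜] X) d := by
  rw [← mem_stableIterationSet_iff]
  have hne : (stableIterationSet T).Nonempty := by
    by_contra hempty
    simp [dis, Set.not_nonempty_iff_eq_empty.1 hempty] at h
  have hs : dis T = (sInf (stableIterationSet T) : ℕ) := by
    refine le_antisymm (iInf₂_le _ (Nat.sInf_mem hne)) (le_iInf₂ fun n hn => ?_)
    exact_mod_cast Nat.sInf_le hn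
  have : sInf (stableIterationSet T) = d := by
    rw [h] at hs
    exact_mod_cast hs.symm
  exact this ▸ Nat.sInf_mem hne

lemma exists_dis_eq_of_stableAt {T : X →L[𝕜] X} {e : ℕ} (h : StableAt (T : X →ₗ[𝕜] X) e) :
    ∃ d : ℕ, dis T = d := by
  have hle : dis T ≤ e := iInf₂_le e (mem_stableIterationSet_iff.2 h)
  exact ⟨(dis T).toNat, (ENat.natCast_toNat (ne_top_of_le_ne_top (ENat.natCast_ne_top e) hle)).symm⟩

lemma essLE_ker_inf_range {L M : Module.End 𝕜 X} (hLM : (L - M).HasFiniteRange) {d e : ℕ}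
    (hL : StableAt L d) (hM : StableAt M e) :
    EssLE (LinearMap.ker L ⊓ LinearMap.range (L ^ d))
      (LinearMap.ker M ⊓ LinearMap.range (M ^ e)) := by
  rw [← hL.ker_inf_range_eq (le_max_left d e), ← hM.ker_inf_range_eq (le_max_right d e)]
  exact (EssLE.ker_of_sub hLM).inf (EssLE.range_of_sub (hasFiniteRange_pow_sub_pow hLM _))

lemma essLE_range_sup_ker {L M : Module.End 𝕜 X} (hLM : (L - M).HasFiniteRange) {d e : ℕ}
    (hL : StableAt L d) (hM : StableAt M e) :
    EssLE (LinearMap.range L ⊔ LinearMap.ker (L ^ d))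
      (LinearMap.range M ⊔ LinearMap.ker (M ^ e)) := by
  rw [← hL.range_sup_ker_eq (le_max_left d e), ← hM.range_sup_ker_eq (le_max_right d e)]
  exact (EssLE.range_of_sub hLM).sup (EssLE.ker_of_sub (hasFiniteRange_pow_sub_pow hLM _))

end QuasiFredholm

theorem mainTheorem3 {𝕜 X : Type*} [RCLike 𝕜] [NormedAddCommGroup X] [NormedSpace 𝕜 X]
    [CompleteSpace X] (T F : X →L[𝕜] X) (hT : IsQuasiFredholm T)
    (hF : FiniteDimensional 𝕜 F.range) :
    IsQuasiFredholm (T + F) ∧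
    ∀ d d' : ℕ, dis T = (d : ℕ∞) → dis (T + F) = (d' : ℕ∞) →
      (FiniteDimensional 𝕜 (T.ker ⊓ (T ^ d).range : Submodule 𝕜 X) →
        FiniteDimensional 𝕜 ((T + F).ker ⊓ ((T + F) ^ d').range : Submodule 𝕜 X)) ∧
      (FiniteDimensional 𝕜 (X ⧸ (T.range ⊔ (T ^ d).ker)) →
        FiniteDimensional 𝕜 (X ⧸ ((T + F).range ⊔ ((T + F) ^ d').ker))) := by
  have hFfin : (F : X →ₗ[𝕜] X).HasFiniteRange := Module.Finite.iff_fg.1 hF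
  have hST : (((T + F : X →L[𝕜] X) : Module.End 𝕜 X) - (T : Module.End 𝕜 X)).HasFiniteRange := by
    simpa using hFfin
  have hTS : ((T : Module.End 𝕜 X) - ((T + F : X →L[𝕜] X) : Module.End 𝕜 X)).HasFiniteRange := by
    simpa using hFfin.neg
  obtain ⟨d, hd, ⟨hinf, hinfc⟩, hsup, hsupc⟩ := hT
  have hdT := stableAt_of_dis_eq hd
  obtain ⟨e, he⟩ := hdT.exists_of_finite_rank hFfin
  obtain ⟨d', hd'⟩ := exists_dis_eq_of_stableAt (T := T + F) (by simpa using he)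
  have hdS := stableAt_of_dis_eq hd'
  simp only [ContinuousLinearMap.toLinearMap_pow] at hinf hinfc hsup hsupc ⊢
  have hran : ∀ n, d ≤ n →
      IsClosed (LinearMap.range (((T + F : X →L[𝕜] X) : X →ₗ[𝕜] X) ^ n) : Set X) := by
    intro n hn
    have hc := hdT.isClosed_range_pow hinf hsup hn
    rw [← ContinuousLinearMap.toLinearMap_pow] at hc ⊢
    refine isClosed_range_of_sub_finiteRank hc ?_
    rw [ContinuousLinearMap.toLinearMap_pow, ContinuousLinearMap.toLinearMap_pow]
    exact hasFiniteRange_pow_sub_pow hST n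
  refine ⟨⟨d', hd', ?_⟩, fun c c' hc hc' => ⟨fun hfin => ?_, fun hfin => ?_⟩⟩
  · simp only [ContinuousLinearMap.toLinearMap_pow]
    have hinf' : IsClosed (((T + F).ker ⊓
        LinearMap.range (((T + F : X →L[𝕜] X) : X →ₗ[𝕜] X) ^ d') : Submodule 𝕜 X) : Set X) := by
      rw [← hdS.ker_inf_range_eq (le_max_right d d')]
      exact (T + F).isClosed_ker.inter (hran _ (le_max_left _ _))
    have hsup' : IsClosed (((T + F).range ⊔
        LinearMap.ker (((T + F : X →L[𝕜] X) : X →ₗ[𝕜] X) ^ d') : Submodule 𝕜 X) : Set X) := by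
      rw [← hdS.range_sup_ker_eq (le_max_right d d'), range_sup_ker_pow_eq_comap]
      have hclosed := (hran (max d d' + 1) (by omega)).preimage ((T + F) ^ max d d').continuous
      rwa [← ContinuousLinearMap.coe_coe ((T + F) ^ max d d'),
        ContinuousLinearMap.toLinearMap_pow] at hclosed
    exact ⟨⟨hinf', closedComplemented_of_essLE hinfc hinf' (essLE_ker_inf_range hTS hdT hdS)
        (essLE_ker_inf_range hST hdS hdT)⟩,
      ⟨hsup', closedComplemented_of_essLE hsupc hsup' (essLE_range_sup_ker hTS hdT hdS)
        (essLE_range_sup_ker hST hdS hdT)⟩⟩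
  · rw [ContinuousLinearMap.toLinearMap_pow] at hfin ⊢
    exact Module.Finite.iff_fg.2 ((essLE_ker_inf_range hST (stableAt_of_dis_eq hc')
      (stableAt_of_dis_eq hc)).fg (Module.Finite.iff_fg.1 hfin))
  · rw [ContinuousLinearMap.toLinearMap_pow] at hfin ⊢
    exact (essLE_range_sup_ker hTS (stableAt_of_dis_eq hc) (stableAt_of_dis_eq hc')).coFG hfin
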